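/- **Theorem (A Björling type problem for SL normal bundles).** Let $I\subset\mathbb R$ be an interval of positive length, and let $\gamma_1,\gamma_2:I\to\mathbb R^3$ be real-analytic curves (real-analytic on a neighbourhood of each point of $I$) such that, for all $t\in I$, $$\gamma_1'(t)\neq 0,\qquad \gamma_1'(t)\cdot\gamma_2(t)=0,\qquad \gamma_2(t)\neq 0 .$$ Then there is a special Lagrangian normal bundle in $\mathbb C^3=\mathbb R^3\oplus\mathbb R^3$ that contains the complex curve $\gamma_1+i\gamma_2$. That is, there are a connected open set $U\subset\mathbb R^2$ and a smooth immersion $X:U\to\mathbb R^3$ whose normal bundle $$\nu(X)=\{(u,v)\in U\times\mathbb R^3:\ v\perp dX_u(\mathbb R^2)\},$$ immersed in $\mathbb C^3$ by $(u,v)\mapsto X(u)+iv$, is a special Lagrangian submanifold of phase $i$, and there is a continuous curve $c:I\to\nu(X)$ whose image under this immersion is $\gamma_1(t)+i\gamma_2(t)$ for all $t\in I$. Here an immersed 3-dimensional submanifold of $\mathbb C^3$ is special Lagrangian of phase $e^{i\theta}$ if each of its tangent spaces is Lagrangian for $\sum_k dx_k\wedge dy_k$ and, for a suitable orientation, is calibrated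 by $\mathrm{Re}(e^{-i\theta}dz_1\wedge dz_2\wedge dz_3)$ (this form takes the value $1$ on its oriented orthonormal bases). -/

import Mathlib

open scoped ContDiff

noncomputable section

/-- The point `x + i y` of `ℂⁿ = ℝⁿ ⊕ ℝⁿ`. -/
def complexPoint {n : ℕ} (x y : EuclideanSpace ℝ (Fin n)) : EuclideanSpace ℂ (Fin n) :=
  WithLp.toLp 2 fun k => (x k : ℂ) + Complex.I * (y k : ℂ)

/-- The standard symplectic form `dx₁ ∧ dy₁ + ⋯ + dxₙ ∧ dyₙ` on `ℂⁿ`. -/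
def kahlerForm {n : ℕ} (v w : EuclideanSpace ℂ (Fin n)) : ℝ :=
  ∑ k, ((v k).re * (w k).im - (v k).im * (w k).re)

/-- The holomorphic volume form `dz₁ ∧ ⋯ ∧ dzₙ` on `ℂⁿ`. -/
def holomorphicVolume {n : ℕ} (v : Fin n → EuclideanSpace ℂ (Fin n)) : ℂ :=
  Matrix.det (Matrix.of fun j k => v j k)

/-- The special Lagrangian calibration of phase `exp (i θ)`: the real `n`-form
`Re (exp (-i θ) dz₁ ∧ ⋯ ∧ dzₙ)`. -/
def slCalibration {n : ℕ} (θ : ℝ) (v : Fin n → EuclideanSpace ℂ (Fin n)) : ℝ :=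
  (Complex.exp (-(θ * Complex.I)) * holomorphicVolume v).re

/-- A real subspace `P` of `ℂⁿ` is a special Lagrangian plane of phase `exp (i θ)`: it is Lagrangian
and, for a suitable orientation (the one given by the basis `e`), it is calibrated by the special
Lagrangian calibration. The orthonormal basis, for the real inner product `Re ⟨v, w⟩`, makes `P` a
real `n`-dimensional subspace. -/
def IsSpecialLagrangianPlane {n : ℕ} (θ : ℝ) (P : Submodule ℝ (EuclideanSpace ℂ (Fin n))) : Prop :=
  (∀ v ∈ P, ∀ w ∈ P, kahlerForm v w = 0) ∧
    ∃ e : OrthonormalBasis (Fin n) ℝ P,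
      slCalibration θ (fun j => (e j : EuclideanSpace ℂ (Fin n))) = 1

/-- `X : U → ℝⁿ` is a connected, smoothly immersed `m`-dimensional submanifold, parametrized by
an open set `U ⊆ ℝᵐ`. -/
structure IsImmersedSubmanifold {m n : ℕ} (U : Set (EuclideanSpace ℝ (Fin m)))
    (X : EuclideanSpace ℝ (Fin m) → EuclideanSpace ℝ (Fin n)) : Prop where
  isOpen : IsOpen U
  isConnected : IsConnected U
  contDiffOn : ContDiffOn ℝ ∞ X U
  injective_fderiv : ∀ u ∈ U, Function.Injective (fderiv ℝ X u)

/-- The function `(u, v) ↦ (w ↦ ⟨dX_u w, v⟩)`. It vanishes exactly when `v` is normal to `X` at `u`.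
When `X` is an immersion, its differential is onto, already in the direction of `v`. -/
def normalEquation {m n : ℕ} (X : EuclideanSpace ℝ (Fin m) → EuclideanSpace ℝ (Fin n))
    (p : EuclideanSpace ℝ (Fin m) × EuclideanSpace ℝ (Fin n)) :
    EuclideanSpace ℝ (Fin m) →L[ℝ] ℝ :=
  (innerSL ℝ p.2).comp (fderiv ℝ X p.1)

/-- The (total space of the) normal bundle of `X : U → ℝⁿ`: all pairs `(u, v)` with `u ∈ U` and `v`
orthogonal to the tangent space `dX_u (ℝᵐ)`. For an immersion it is an `n`-dimensional
submanifold of `U × ℝⁿ`, the regular zero set of `normalEquation X`. -/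
def normalBundle {m n : ℕ} (U : Set (EuclideanSpace ℝ (Fin m)))
    (X : EuclideanSpace ℝ (Fin m) → EuclideanSpace ℝ (Fin n)) :
    Set (EuclideanSpace ℝ (Fin m) × EuclideanSpace ℝ (Fin n)) :=
  {p | p.1 ∈ U ∧ ∀ w, inner ℝ (fderiv ℝ X p.1 w) p.2 = 0}

theorem mem_normalBundle_iff {m n : ℕ} (U : Set (EuclideanSpace ℝ (Fin m)))
    (X : EuclideanSpace ℝ (Fin m) → EuclideanSpace ℝ (Fin n))
    (p : EuclideanSpace ℝ (Fin m) × EuclideanSpace ℝ (Fin n)) :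
    p ∈ normalBundle U X ↔ p.1 ∈ U ∧ normalEquation X p = 0 := by
  simp [normalBundle, normalEquation, ContinuousLinearMap.ext_iff, real_inner_comm]

/-- The map `(u, v) ↦ X u + i v`, which immerses the normal bundle of `X` in `ℂⁿ = ℝⁿ ⊕ ℝⁿ`. -/
def normalBundleMap {m n : ℕ} (X : EuclideanSpace ℝ (Fin m) → EuclideanSpace ℝ (Fin n))
    (p : EuclideanSpace ℝ (Fin m) × EuclideanSpace ℝ (Fin n)) : EuclideanSpace ℂ (Fin n) :=
  complexPoint (X p.1) p.2

/-- The tangent space in `ℂⁿ` of the immersed normal bundle of `X` at its point `p`: the image, under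
the differential of `(u, v) ↦ X u + i v`, of the tangent space of the regular zero set of
`normalEquation X`, which is the kernel of the differential of that function. -/
def normalBundleTangentSpace {m n : ℕ}
    (X : EuclideanSpace ℝ (Fin m) → EuclideanSpace ℝ (Fin n))
    (p : EuclideanSpace ℝ (Fin m) × EuclideanSpace ℝ (Fin n)) :
    Submodule ℝ (EuclideanSpace ℂ (Fin n)) :=
  Submodule.map (fderiv ℝ (normalBundleMap X) p).toLinearMap
    (LinearMap.ker (fderiv ℝ (normalEquation X) p).toLinearMap)

/-- The normal bundle of `X : U → ℝⁿ` is a special Lagrangian submanifold of `ℂⁿ`, of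
phase `exp (i θ)`. -/
def IsSpecialLagrangianNormalBundle {m n : ℕ} (θ : ℝ) (U : Set (EuclideanSpace ℝ (Fin m)))
    (X : EuclideanSpace ℝ (Fin m) → EuclideanSpace ℝ (Fin n)) : Prop :=
  ∀ p ∈ normalBundle U X, IsSpecialLagrangianPlane θ (normalBundleTangentSpace X p)

end

/-!
The normal bundle of an immersed surface in `ℝ³` is special Lagrangian of phase `i` in `ℂ³` when the
surface is minimal (Harvey and Lawson), so the theorem follows from the classical Björling problem:
there is a minimal surface through the curve `γ₁` whose unit normal along it is `n = γ₂ / |γ₂|`. The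
curve `γ₁ + i γ₂` then lies in its normal bundle. H. A. Schwarz solved that problem by the formula
`X = Re F`, where `F` is the holomorphic extension of `γ₁ - i ∫ n × γ₁'` to a neighbourhood of `I`.

* The extension is given by one formula, the Taylor series of the real curve in the imaginary
  direction (`complexExtension`), so local extensions need not be glued. The primitive `∫ n × γ₁'`
  is again real-analytic (`AnalyticOnNhd.exists_primitive`).
* Along `I`, the real and imaginary parts of `F'` are `γ₁'` and `-n × γ₁'`, which are orthogonal and
  of equal length. Hence `F'₁² + F'₂² + F'₃²` vanishes on `I`, and by the identity theorem on the
  connected domain. Thus `∂₁X = Re F'` and `∂₂X = Re (i F')` form a conformal frame, and `X` is an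
  immersion wherever `F' ≠ 0`.
* Let `s = |∂₁X|² = |∂₂X|²` and let `v` be a normal vector. Since `X` is harmonic, the second
  fundamental form in the direction `v` has a matrix `(p, q; q, -p)` in this frame. The tangent space
  of the normal bundle at `v` consists of the points `(a₁ ∂₁X + a₂ ∂₂X) + i b` whose `b` has the
  tangential components prescribed by that matrix. Symmetry makes this space Lagrangian. As the trace
  vanishes, its natural basis is orthogonal, and its complex determinant is `i` times a positive
  number, so that normalizing the basis makes the determinant `i`
  (`isSpecialLagrangianPlane_of_traceless`).
-/

/-! ### Complexification of real-analytic curves -/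

section Complexification

open Filter Topology Metric

variable {E : Type*} [NormedAddCommGroup E] [NormedSpace ℂ E]

/-- Near a point where it is analytic, a function of a real variable is the restriction of a
holomorphic function: its power series makes sense for complex arguments. -/
theorem AnalyticAt.exists_complex_extension [CompleteSpace E] {f : ℝ → E} {t : ℝ}
    (hf : AnalyticAt ℝ f t) :
    ∃ H : ℂ → E, AnalyticAt ℂ H t ∧ ∀ᶠ s : ℝ in 𝓝 t, H s = f s := by
  obtain ⟨p, hp⟩ := hf
  let q : FormalMultilinearSeries ℂ ℂ E :=
    fun n => ContinuousMultilinearMap.mkPiRing ℂ (Fin n) (p.coeff n)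
  have hnorm : ∀ n, ‖q n‖₊ = ‖p n‖₊ := by
    intro n
    apply NNReal.eq
    simp [q, FormalMultilinearSeries.norm_apply_eq_norm_coef]
  have hrad : q.radius = p.radius := by
    simp only [FormalMultilinearSeries.radius, ← coe_nnnorm, hnorm]
  have hpos : 0 < q.radius := by
    rw [hrad]
    exact hp.radius_pos
  have hq := (q.hasFPowerSeriesOnBall hpos).comp_sub (t : ℂ)
  rw [zero_add] at hq
  refine ⟨_, hq.analyticAt, ?_⟩
  filter_upwards [hasFPowerSeriesAt_iff'.1 hp] with s hs
  rw [← hs.tsum_eq]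
  refine tsum_congr fun n => ?_
  have h : (fun _ : Fin n => (s : ℂ) - (t : ℂ)) = fun _ => ((s - t : ℝ) : ℂ) := by
    simp
  simp only [h, q, ContinuousMultilinearMap.mkPiRing_apply, Finset.prod_const, Finset.card_univ,
    Fintype.card_fin, ← Complex.ofReal_pow]
  exact Complex.coe_smul _ _

/-- The candidate for the holomorphic extension of `f : ℝ → E`: at `x + i y`, the value of the
Taylor series of `f` at `x` in the imaginary direction. It needs no choice of local extensions, so
that no gluing is necessary. -/
noncomputable def complexExtension (f : ℝ → E) (z : ℂ) : E :=
  ∑' n : ℕ, (n.factorial : ℂ)⁻¹ • (Complex.I * z.im) ^ n • iteratedDeriv n f z.re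

theorem complexExtension_ofReal (f : ℝ → E) (s : ℝ) : complexExtension f s = f s := by
  rw [complexExtension, tsum_eq_single 0]
  · simp
  · intro n hn
    simp [hn]

/-- The real derivatives of a function that extends holomorphically are the complex derivatives of
the extension. -/
theorem iteratedDeriv_comp_ofReal [CompleteSpace E] {H : ℂ → E} {f : ℝ → E} {t r : ℝ}
    (hH : DifferentiableOn ℂ H (ball (t : ℂ) r)) (hf : ∀ s ∈ ball t r, H s = f s) (n : ℕ) :
    ∀ s ∈ ball t r, iteratedDeriv n f s = iteratedDeriv n H s := by
  induction n with
  | zero => simpa using fun s hs => (hf s hs).symm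
  | succ n ih =>
    intro s hs
    have hs' : (s : ℂ) ∈ ball (t : ℂ) r := by
      simpa [Complex.dist_eq, ← Complex.ofReal_sub, Real.dist_eq] using hs
    have han : AnalyticAt ℂ H s := hH.analyticAt (isOpen_ball.mem_nhds hs')
    have hd : DifferentiableAt ℂ (iteratedDeriv n H) s := by
      rw [iteratedDeriv_eq_iterate]
      exact (han.iterated_deriv n).differentiableAt
    rw [iteratedDeriv_succ, iteratedDeriv_succ,
      EventuallyEq.deriv_eq (f := fun y : ℝ => iteratedDeriv n H y)]
    · simpa [Function.comp_def] using (hd.hasDerivAt.scomp s Complex.ofRealCLM.hasDerivAt).deriv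
    · filter_upwards [isOpen_ball.mem_nhds hs] with y hy using ih y hy

/-- The Taylor formula in the imaginary direction extends a real-analytic function to a
holomorphic one near each real point where the function is analytic. -/
theorem AnalyticAt.complexExtension [CompleteSpace E] {f : ℝ → E} {t : ℝ} (hf : AnalyticAt ℝ f t) :
    AnalyticAt ℂ (complexExtension f) t := by
  -- Near `t` the series is the Taylor series of a local extension `H` at the real point `z.re`,
  -- summed at `z`; halving the radius keeps the disc of convergence inside the domain of `H`.
  obtain ⟨H, hH, hHf⟩ := hf.exists_complex_extension
  obtain ⟨r₁, hr₁, hb₁⟩ := Metric.eventually_nhds_iff_ball.1 hH.eventually_analyticAt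
  obtain ⟨r₂, hr₂, hb₂⟩ := Metric.eventually_nhds_iff_ball.1 hHf
  set r := min r₁ r₂ with hr
  have hr0 : 0 < r := lt_min hr₁ hr₂
  have hdiff : DifferentiableOn ℂ H (ball (t : ℂ) r) := fun z hz =>
    (hb₁ z (ball_subset_ball (min_le_left _ _) hz)).differentiableAt.differentiableWithinAt
  have heq : ∀ s ∈ ball t r, H s = f s := fun s hs => hb₂ s (ball_subset_ball (min_le_right _ _) hs)
  refine hH.congr ?_
  filter_upwards [ball_mem_nhds (t : ℂ) (half_pos hr0)] with z hz
  have hz1 : |z.re - t| < r / 2 := by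
    refine lt_of_le_of_lt ?_ (mem_ball_iff_norm.1 hz)
    simpa using Complex.abs_re_le_norm (z - t)
  have hz2 : |z.im| < r / 2 := by
    refine lt_of_le_of_lt ?_ (mem_ball_iff_norm.1 hz)
    simpa using Complex.abs_im_le_norm (z - t)
  have hsub : ball (z.re : ℂ) (r / 2) ⊆ ball (t : ℂ) r := by
    apply ball_subset_ball'
    rw [Complex.dist_eq, ← Complex.ofReal_sub, Complex.norm_real, Real.norm_eq_abs]
    linarith
  have hzI : z - z.re = Complex.I * z.im := by
    apply Complex.ext <;> simp
  have hmem : z ∈ ball (z.re : ℂ) (r / 2) := by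
    rw [mem_ball_iff_norm, hzI]
    simpa using hz2
  have key := Complex.taylorSeries_eq_on_ball (hdiff.mono hsub) hmem
  rw [hzI] at key
  rw [← key, _root_.complexExtension]
  refine tsum_congr fun n => ?_
  rw [iteratedDeriv_comp_ofReal hdiff heq n]
  rw [mem_ball, Real.dist_eq]
  linarith

end Complexification

/-! ### Real-analytic primitives -/

section Primitive

open Filter Topology Metric Set

/-- A primitive of a real-analytic function is real-analytic: up to a constant it is the real part
of a holomorphic primitive of the complexified function. -/
theorem AnalyticAt.of_hasDerivAt {g h : ℝ → ℝ} {t : ℝ} (hh : AnalyticAt ℝ h t)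
    (hg : ∀ᶠ s in 𝓝 t, HasDerivAt g (h s) s) : AnalyticAt ℝ g t := by
  obtain ⟨H, hH, hHf⟩ := (Complex.ofRealCLM.analyticAt (h t)).comp hh |>.exists_complex_extension
  obtain ⟨r₁, hr₁, hb₁⟩ := Metric.eventually_nhds_iff_ball.1 hH.eventually_analyticAt
  obtain ⟨r, hr, hb⟩ := Metric.eventually_nhds_iff_ball.1 (hHf.and hg)
  obtain ⟨G, hG⟩ := DifferentiableOn.isExactOn_ball (c := (t : ℂ)) (r := r₁)
    fun z hz => (hb₁ z hz).differentiableAt.differentiableWithinAt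
  have hGan : AnalyticAt ℂ G t :=
    DifferentiableOn.analyticAt (s := ball (t : ℂ) r₁)
      (fun z hz => (hG z hz).differentiableAt.differentiableWithinAt) (ball_mem_nhds _ hr₁)
  have hGre : AnalyticAt ℝ (fun s : ℝ => (G s).re) t :=
    (Complex.reCLM.analyticAt _).comp
      ((hGan.restrictScalars (𝕜 := ℝ)).comp (Complex.ofRealCLM.analyticAt t))
  set ρ := min r₁ r with hρ
  have hρ0 : 0 < ρ := lt_min hr₁ hr
  have hder : ∀ s ∈ ball t ρ, HasDerivAt (fun s : ℝ => g s - (G s).re) 0 s := by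
    intro s hs
    have hs' : (s : ℂ) ∈ ball (t : ℂ) r₁ := by
      have := ball_subset_ball (min_le_left _ _) hs
      simpa [Complex.dist_eq, ← Complex.ofReal_sub, Real.dist_eq] using this
    obtain ⟨h1, h2⟩ := hb s (ball_subset_ball (min_le_right _ _) hs)
    have h3 := (hG _ hs').real_of_complex
    rw [h1] at h3
    have h4 := h2.sub h3
    rw [Function.comp_apply, Complex.ofRealCLM_apply, Complex.ofReal_re, sub_self] at h4
    exact h4
  have hconst : ∀ s ∈ ball t ρ, g s - (G s).re = g t - (G t).re := by
    intro s hs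
    refine (convex_ball t ρ).is_const_of_fderivWithin_eq_zero (𝕜 := ℝ)
      (f := fun s : ℝ => g s - (G s).re)
      (fun x hx => (hder x hx).differentiableAt.differentiableWithinAt) ?_ hs (mem_ball_self hρ0)
    intro x hx
    rw [fderivWithin_of_isOpen isOpen_ball hx]
    ext
    simpa using (hder x hx).deriv
  refine (hGre.add (analyticAt_const (v := g t - (G t).re))).congr ?_
  filter_upwards [ball_mem_nhds t hρ0] with s hs
  have := hconst s hs
  simp only [Pi.add_apply]
  linarith

theorem AnalyticOnNhd.exists_primitive {h : ℝ → ℝ} {I : Set ℝ} (hI : I.OrdConnected)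
    (hh : AnalyticOnNhd ℝ h I) :
    ∃ g : ℝ → ℝ, AnalyticOnNhd ℝ g I ∧ ∀ t ∈ I, HasDerivAt g (h t) t := by
  rcases I.eq_empty_or_nonempty with rfl | ⟨t₀, ht₀⟩
  · exact ⟨0, by simp [AnalyticOnNhd], by simp⟩
  have hWo : IsOpen {t | AnalyticAt ℝ h t} := isOpen_analyticAt ℝ h
  have hcont : ContinuousOn h {t | AnalyticAt ℝ h t} :=
    fun t ht => (AnalyticAt.continuousAt ht).continuousWithinAt
  have key : ∀ t ∈ I, ∀ᶠ s in 𝓝 t, HasDerivAt (fun s => ∫ x in t₀..s, h x) (h s) s := by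
    intro t ht
    obtain ⟨r, hr, hb⟩ := Metric.eventually_nhds_iff_ball.1 (hh t ht).eventually_analyticAt
    filter_upwards [ball_mem_nhds t hr] with s hs
    -- The path from `t₀` to `s` runs inside `I` as far as `t`, then inside a ball around `t`; so
    -- the integrand is continuous along it even if `s` lies outside `I`.
    have hint₁ : IntervalIntegrable h MeasureTheory.volume t₀ t :=
      (hcont.mono fun x hx => hh x (hI.uIcc_subset ht₀ ht hx)).intervalIntegrable
    have hint₂ : IntervalIntegrable h MeasureTheory.volume t s := by
      refine (hcont.mono fun x hx => hb x ?_).intervalIntegrable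
      rw [Real.ball_eq_Ioo] at hs ⊢
      have ht' : t ∈ Ioo (t - r) (t + r) := ⟨by linarith, by linarith⟩
      exact ordConnected_Ioo.uIcc_subset ht' hs hx
    exact intervalIntegral.integral_hasDerivAt_right (hint₁.trans hint₂)
      (hcont.stronglyMeasurableAtFilter hWo s (hb s hs)) (hb s hs).continuousAt
  exact ⟨_, fun t ht => (hh t ht).of_hasDerivAt (key t ht), fun t ht => (key t ht).self_of_nhds⟩

end Primitive

/-! ### Special Lagrangian planes from traceless second fundamental forms -/

section LinearAlgebra

theorem kahlerForm_complexPoint {n : ℕ} (x y x' y' : EuclideanSpace ℝ (Fin n)) :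
    kahlerForm (complexPoint x y) (complexPoint x' y') = inner ℝ x y' - inner ℝ y x' := by
  simp only [kahlerForm, complexPoint, PiLp.inner_apply, ← Finset.sum_sub_distrib]
  refine Finset.sum_congr rfl fun k _ => ?_
  simp
  ring

theorem inner_complexPoint {n : ℕ} (x y x' y' : EuclideanSpace ℝ (Fin n)) :
    inner ℝ (complexPoint x y) (complexPoint x' y') = inner ℝ x x' + inner ℝ y y' := by
  simp only [complexPoint, PiLp.inner_apply, ← Finset.sum_add_distrib]
  refine Finset.sum_congr rfl fun k _ => ?_
  simp [Complex.inner]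

/-- `complexPoint` as a real linear map. -/
noncomputable def complexPointCLM (n : ℕ) :
    (EuclideanSpace ℝ (Fin n) × EuclideanSpace ℝ (Fin n)) →L[ℝ] EuclideanSpace ℂ (Fin n) :=
  LinearMap.toContinuousLinearMap
    { toFun := fun p => complexPoint p.1 p.2
      map_add' := fun p q => by ext k; simp [complexPoint]; ring
      map_smul' := fun c p => by ext k; simp [complexPoint]; ring }

theorem complexPoint_add {n : ℕ} (x y x' y' : EuclideanSpace ℝ (Fin n)) :
    complexPoint (x + x') (y + y') = complexPoint x y + complexPoint x' y' :=
  (complexPointCLM n).map_add (x, y) (x', y')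

theorem complexPoint_smul {n : ℕ} (c : ℝ) (x y : EuclideanSpace ℝ (Fin n)) :
    complexPoint (c • x) (c • y) = c • complexPoint x y :=
  (complexPointCLM n).map_smul c (x, y)

/-- Euclidean 3-space. -/
abbrev E3 := EuclideanSpace ℝ (Fin 3)

/-- The cross product of `ℝ³`, for vectors of the Euclidean space. -/
noncomputable def cross3 (a b : E3) : E3 :=
  !₂[a 1 * b 2 - a 2 * b 1, a 2 * b 0 - a 0 * b 2, a 0 * b 1 - a 1 * b 0]

theorem inner_e3 (a b : E3) : inner ℝ a b = a 0 * b 0 + a 1 * b 1 + a 2 * b 2 := by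
  simp [PiLp.inner_apply, Fin.sum_univ_three]
  ring

theorem inner_cross3_left (a b : E3) : inner ℝ a (cross3 a b) = 0 := by
  simp [inner_e3, cross3]
  ring

theorem inner_cross3_right (a b : E3) : inner ℝ b (cross3 a b) = 0 := by
  simp [inner_e3, cross3]
  ring

theorem inner_cross3_self (a b : E3) :
    inner ℝ (cross3 a b) (cross3 a b) = inner ℝ a a * inner ℝ b b - inner ℝ a b ^ 2 := by
  simp only [inner_e3]
  simp [cross3]
  ring

/-- Expansion of a vector of `ℝ³` in the orthogonal basis `e₁, e₂, e₁ × e₂`, where `e₁` and `e₂`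
have squared length `s` and `e₁ × e₂` therefore has length `s`. -/
theorem conformal_frame_expansion {e₁ e₂ : E3} {s : ℝ} (hs : 0 < s) (h12 : inner ℝ e₁ e₂ = 0)
    (h11 : inner ℝ e₁ e₁ = s) (h22 : inner ℝ e₂ e₂ = s) (b : E3) :
    b = (inner ℝ b e₁ / s) • e₁ + (inner ℝ b e₂ / s) • e₂ +
      (inner ℝ b (s⁻¹ • cross3 e₁ e₂)) • (s⁻¹ • cross3 e₁ e₂) := by
  have hcc : inner ℝ (cross3 e₁ e₂) (cross3 e₁ e₂) = s ^ 2 := by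
    rw [inner_cross3_self, h11, h22, h12]; ring
  have h1c := inner_cross3_left e₁ e₂
  have h2c := inner_cross3_right e₁ e₂
  have h21 : inner ℝ e₂ e₁ = 0 := by rw [real_inner_comm, h12]
  have hc1 : inner ℝ (cross3 e₁ e₂) e₁ = 0 := by rw [real_inner_comm, h1c]
  have hc2 : inner ℝ (cross3 e₁ e₂) e₂ = 0 := by rw [real_inner_comm, h2c]
  have hsq : 0 < √s := Real.sqrt_pos.2 hs
  have hss : √s * √s = s := Real.mul_self_sqrt hs.le
  have hon : Orthonormal ℝ ![(√s)⁻¹ • e₁, (√s)⁻¹ • e₂, s⁻¹ • cross3 e₁ e₂] := by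
    rw [orthonormal_iff_ite]
    intro i j
    fin_cases i <;> fin_cases j <;>
      simp only [Fin.zero_eta, Fin.mk_one, Fin.reduceFinMk, Matrix.cons_val, inner_smul_left,
        inner_smul_right, h11, h12, h21, h22, h1c, h2c, hc1, hc2, hcc, RCLike.conj_to_real,
        mul_zero, Fin.reduceEq, if_true, if_false, zero_ne_one, one_ne_zero] <;>
      field_simp <;> nlinarith
  let B := (basisOfOrthonormalOfCardEqFinrank hon (by simp)).toOrthonormalBasis (by simpa using hon)
  have hB := B.sum_repr b
  have hBi : ∀ i, B i = ![(√s)⁻¹ • e₁, (√s)⁻¹ • e₂, s⁻¹ • cross3 e₁ e₂] i := by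
    intro i; simp [B]
  simp only [Fin.sum_univ_three, B.repr_apply_apply, hBi, Matrix.cons_val_zero, Matrix.cons_val_one,
    Matrix.cons_val, inner_smul_left, RCLike.conj_to_real, smul_smul] at hB
  conv_lhs => rw [← hB]
  simp only [smul_smul, inner_smul_right, real_inner_comm b]
  have aux : ∀ x : ℝ, (√s)⁻¹ * x * (√s)⁻¹ = x / s := by
    intro x; field_simp; rw [sq, hss, mul_comm]
  simp only [aux]

/-- Pointwise content of the theorem that normal bundles of minimal surfaces are special
Lagrangian: `e₁, e₂` is the conformal frame of the tangent plane and the matrix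
`(p, q; q, -p)` is the second fundamental form in a normal direction, traceless by minimality. -/
theorem isSpecialLagrangianPlane_of_traceless {e₁ e₂ : E3} {s p q : ℝ} (hs : 0 < s)
    (h12 : inner ℝ e₁ e₂ = 0) (h11 : inner ℝ e₁ e₁ = s) (h22 : inner ℝ e₂ e₂ = s)
    {P : Submodule ℝ (EuclideanSpace ℂ (Fin 3))}
    (hP : ∀ x, x ∈ P ↔ ∃ (a₁ a₂ : ℝ) (b : E3), inner ℝ b e₁ = -(a₁ * p + a₂ * q) ∧
      inner ℝ b e₂ = -(a₁ * q - a₂ * p) ∧ complexPoint (a₁ • e₁ + a₂ • e₂) b = x) :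
    IsSpecialLagrangianPlane (Real.pi / 2) P := by
  have h21 : inner ℝ e₂ e₁ = 0 := by rw [real_inner_comm, h12]
  constructor
  · rintro v hv w hw
    obtain ⟨a₁, a₂, b, hb1, hb2, rfl⟩ := (hP _).1 hv
    obtain ⟨a₁', a₂', b', hb1', hb2', rfl⟩ := (hP _).1 hw
    rw [kahlerForm_complexPoint, inner_add_left, inner_add_right, inner_smul_left, inner_smul_left,
      RCLike.conj_to_real, RCLike.conj_to_real]
    simp only [inner_smul_right, hb1, hb2, real_inner_comm b', hb1', hb2']
    ring
  set N : E3 := s⁻¹ • cross3 e₁ e₂ with hN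
  have h1N : inner ℝ e₁ N = 0 := by rw [hN, inner_smul_right, inner_cross3_left, mul_zero]
  have h2N : inner ℝ e₂ N = 0 := by rw [hN, inner_smul_right, inner_cross3_right, mul_zero]
  have hN1 : inner ℝ N e₁ = 0 := by rw [real_inner_comm, h1N]
  have hN2 : inner ℝ N e₂ = 0 := by rw [real_inner_comm, h2N]
  have hNN : inner ℝ N N = 1 := by
    rw [hN, inner_smul_right, inner_smul_left, inner_cross3_self, h11, h22, h12]
    simp
    field_simp
  -- `complexPoint e₁ b₁` and `complexPoint e₂ b₂` have this squared length, and are orthogonal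
  -- because the second fundamental form is symmetric and traceless.
  set m : ℝ := s + (p ^ 2 + q ^ 2) / s with hm
  have hm0 : 0 < m := by positivity
  have hmm : √m * √m = m := Real.mul_self_sqrt hm0.le
  have hmpos : 0 < √m := Real.sqrt_pos.2 hm0
  set b₁ : E3 := (-p / s) • e₁ + (-q / s) • e₂ with hb₁
  set b₂ : E3 := (-q / s) • e₁ + (p / s) • e₂ with hb₂
  have ib11 : inner ℝ b₁ e₁ = -p := by
    rw [hb₁, inner_add_left, real_inner_smul_left, real_inner_smul_left, h11, h21]; field_simp; ring
  have ib12 : inner ℝ b₁ e₂ = -q := by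
    rw [hb₁, inner_add_left, real_inner_smul_left, real_inner_smul_left, h12, h22]; field_simp; ring
  have ib21 : inner ℝ b₂ e₁ = -q := by
    rw [hb₂, inner_add_left, real_inner_smul_left, real_inner_smul_left, h11, h21]; field_simp; ring
  have ib22 : inner ℝ b₂ e₂ = p := by
    rw [hb₂, inner_add_left, real_inner_smul_left, real_inner_smul_left, h12, h22]; field_simp; ring
  have ib1N : inner ℝ b₁ N = 0 := by
    simp [hb₁, inner_add_left, inner_smul_left, h1N, h2N]
  have ib2N : inner ℝ b₂ N = 0 := by
    simp [hb₂, inner_add_left, inner_smul_left, h1N, h2N]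
  have jb11 : inner ℝ b₁ b₁ = (p ^ 2 + q ^ 2) / s := by
    conv_lhs => rw [hb₁]
    rw [← hb₁, inner_add_right, inner_smul_right, inner_smul_right, ib11, ib12]; ring
  have jb12 : inner ℝ b₁ b₂ = 0 := by
    rw [hb₂, inner_add_right, inner_smul_right, inner_smul_right, ib11, ib12]; ring
  have jb22 : inner ℝ b₂ b₂ = (p ^ 2 + q ^ 2) / s := by
    conv_lhs => rw [hb₂]
    rw [← hb₂, inner_add_right, inner_smul_right, inner_smul_right, ib21, ib22]; ring
  let f : Fin 3 → EuclideanSpace ℂ (Fin 3) :=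
    ![(√m)⁻¹ • complexPoint e₁ b₁, (√m)⁻¹ • complexPoint e₂ b₂, complexPoint 0 N]
  have hcp1 : complexPoint e₁ b₁ ∈ P :=
    (hP _).2 ⟨1, 0, b₁, by simp [ib11], by simp [ib12], by simp⟩
  have hcp2 : complexPoint e₂ b₂ ∈ P :=
    (hP _).2 ⟨0, 1, b₂, by simp [ib21], by simp [ib22], by simp⟩
  have hcp3 : complexPoint 0 N ∈ P :=
    (hP _).2 ⟨0, 0, N, by simp [hN1], by simp [hN2], by simp⟩
  have hfP : ∀ i, f i ∈ P := by
    intro i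
    fin_cases i
    · exact P.smul_mem _ hcp1
    · exact P.smul_mem _ hcp2
    · exact hcp3
  have hon : Orthonormal ℝ fun i => (⟨f i, hfP i⟩ : P) := by
    rw [orthonormal_iff_ite]
    intro i j
    have jb21 : inner ℝ b₂ b₁ = 0 := by rw [real_inner_comm, jb12]
    have iN1 : inner ℝ N b₁ = 0 := by rw [real_inner_comm, ib1N]
    have iN2 : inner ℝ N b₂ = 0 := by rw [real_inner_comm, ib2N]
    rw [Submodule.coe_inner]
    fin_cases i <;> fin_cases j <;>
      simp only [f, Fin.zero_eta, Fin.mk_one, Fin.reduceFinMk, Matrix.cons_val, inner_smul_left,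
        inner_smul_right, inner_complexPoint, h11, h12, h21, h22, jb11, jb12, jb22, jb21, iN1, iN2,
        ib1N, ib2N, hNN, inner_zero_left, inner_zero_right, RCLike.conj_to_real,
        mul_zero, add_zero, zero_add, Fin.reduceEq, if_true, if_false, zero_ne_one, one_ne_zero,
        ← hm]
    all_goals
      rw [← mul_assoc, ← mul_inv, hmm, inv_mul_cancel₀ hm0.ne']
  have hspan : ⊤ ≤ Submodule.span ℝ (Set.range fun i => (⟨f i, hfP i⟩ : P)) := by
    rintro ⟨x, hx⟩ -
    obtain ⟨a₁, a₂, b, hb1, hb2, rfl⟩ := (hP _).1 hx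
    have hexp := conformal_frame_expansion hs h12 h11 h22 b
    rw [hb1, hb2, ← hN] at hexp
    rw [Submodule.mem_span_range_iff_exists_fun]
    refine ⟨![√m * a₁, √m * a₂, inner ℝ b N], ?_⟩
    apply Subtype.ext
    simp only [Fin.sum_univ_three, f, Matrix.cons_val_zero, Matrix.cons_val_one, Matrix.cons_val,
      Submodule.coe_add, Submodule.coe_smul, smul_smul]
    rw [mul_comm (√m) a₁, mul_comm (√m) a₂, mul_assoc, mul_assoc, mul_inv_cancel₀ hmpos.ne',
      mul_one, mul_one, ← complexPoint_smul, ← complexPoint_smul, ← complexPoint_smul,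
      ← complexPoint_add, ← complexPoint_add, smul_zero, add_zero]
    congr 1
    conv_rhs => rw [hexp]
    rw [hb₁, hb₂]
    module
  refine ⟨OrthonormalBasis.mk hon hspan, ?_⟩
  have hexp : Complex.exp (-((Real.pi / 2 : ℝ) * Complex.I)) = -Complex.I := by
    rw [Complex.exp_neg]
    simp [Complex.exp_pi_div_two_mul_I]
  -- In the frame `e₁, e₂, N` the three vectors have the coefficient matrix
  -- `(1 - i p/s, -i q/s, 0; -i q/s, 1 + i p/s, 0; 0, 0, i)`, up to the normalization. Its
  -- determinant `i (1 + (p² + q²)/s²)` is a positive multiple of `i` because the trace vanishes.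
  have hdet : holomorphicVolume (fun j => f j) = Complex.I := by
    have hR : e₁ 0 * (e₂ 1 * N 2 - e₂ 2 * N 1) - e₁ 1 * (e₂ 0 * N 2 - e₂ 2 * N 0)
        + e₁ 2 * (e₂ 0 * N 1 - e₂ 1 * N 0) = s := by
      have h := inner_cross3_self e₁ e₂
      rw [h11, h22, h12] at h
      have h' : inner ℝ (cross3 e₁ e₂) N = s := by
        rw [hN, inner_smul_right, h]; field_simp; simp
      rw [← h']
      simp [inner_e3, cross3]
      ring
    have hRc := congrArg (Complex.ofReal) hR
    push_cast at hRc
    have hmc : (√m : ℂ)⁻¹ * (√m : ℂ)⁻¹ * (1 + (p / s) ^ 2 + (q / s) ^ 2) * s = 1 := by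
      have h : (√m)⁻¹ * (√m)⁻¹ * (1 + (p / s) ^ 2 + (q / s) ^ 2) * s = 1 := by
        rw [← mul_inv, hmm, mul_assoc, inv_mul_eq_one₀ hm0.ne', hm]
        field_simp
        ring
      exact_mod_cast h
    have hI : Complex.I ^ 2 = -1 := Complex.I_sq
    simp only [holomorphicVolume, Matrix.det_fin_three, Matrix.of_apply, f, Matrix.cons_val,
      PiLp.smul_apply, complexPoint, hb₁, hb₂, PiLp.add_apply, smul_eq_mul, PiLp.zero_apply,
      Complex.real_smul]
    push_cast
    generalize (√m : ℂ)⁻¹ = k at hmc ⊢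
    simp only [neg_div]
    generalize (p / s : ℂ) = P' at hmc ⊢
    generalize (q / s : ℂ) = Q' at hmc ⊢
    linear_combination (k * k * Complex.I * (1 - Complex.I ^ 2 * (P' ^ 2 + Q' ^ 2))) * hRc
      - k * k * Complex.I * (P' ^ 2 + Q' ^ 2) * s * hI + Complex.I * hmc
  rw [slCalibration, hexp]
  have : (fun j => ((OrthonormalBasis.mk hon hspan j : P) : EuclideanSpace ℂ (Fin 3))) = f := by
    ext1 j; simp
  rw [this, hdet]
  simp

end LinearAlgebra

/-! ### Minimal surfaces as real parts of isotropic holomorphic curves -/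

section MinimalSurface

open Filter Topology

/-- The identification of `ℝ²` with `ℂ`. -/
noncomputable def planeToComplex : EuclideanSpace ℝ (Fin 2) ≃ₗᵢ[ℝ] ℂ :=
  Complex.orthonormalBasisOneI.repr.symm

theorem planeToComplex_apply (w : EuclideanSpace ℝ (Fin 2)) :
    planeToComplex w = w 0 + w 1 * Complex.I := by
  rw [planeToComplex, ← Complex.orthonormalBasisOneI.sum_repr_symm]
  simp [Fin.sum_univ_two]

/-- The componentwise real part `ℂ³ → ℝ³`. -/
noncomputable def rePart : (Fin 3 → ℂ) →L[ℝ] E3 :=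
  LinearMap.toContinuousLinearMap
    { toFun := fun c => WithLp.toLp 2 fun k => (c k).re
      map_add' := fun c d => by ext k; simp
      map_smul' := fun r c => by ext k; simp }

@[simp]
theorem rePart_apply (c : Fin 3 → ℂ) (k : Fin 3) : rePart c k = (c k).re := rfl

/-- The differential of the real part of a holomorphic curve with derivative `c`: the map
`w ↦ Re (w c)`, depending linearly on `c`. -/
noncomputable def reDiff : (Fin 3 → ℂ) →L[ℝ] (EuclideanSpace ℝ (Fin 2) →L[ℝ] E3) :=
  LinearMap.toContinuousLinearMap
    { toFun := fun c =>
        rePart.comp ((planeToComplex.toContinuousLinearEquiv.toContinuousLinearMap).smulRight c)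
      map_add' := fun c d => by ext w k; simp
      map_smul' := fun r c => by ext w k; simp; ring }

theorem reDiff_apply (c : Fin 3 → ℂ) (w : EuclideanSpace ℝ (Fin 2)) :
    reDiff c w = rePart (planeToComplex w • c) := rfl

theorem rePart_smul (z : ℂ) (c : Fin 3 → ℂ) :
    rePart (z • c) = z.re • rePart c + z.im • rePart (Complex.I • c) := by
  ext k
  simp
  ring

theorem reDiff_eq (c : Fin 3 → ℂ) (w : EuclideanSpace ℝ (Fin 2)) :
    reDiff c w = w 0 • rePart c + w 1 • rePart (Complex.I • c) := by
  rw [reDiff_apply, rePart_smul, planeToComplex_apply]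
  simp

/-- The real and imaginary parts of an isotropic vector are orthogonal and of equal length; the real
part of `i c` is minus the imaginary part of `c`. -/
theorem inner_rePart_of_isotropic {c : Fin 3 → ℂ} (hc : ∑ k, c k ^ 2 = 0) :
    inner ℝ (rePart c) (rePart (Complex.I • c)) = 0 ∧
      inner ℝ (rePart (Complex.I • c)) (rePart (Complex.I • c)) =
        inner ℝ (rePart c) (rePart c) := by
  have hre := congrArg Complex.re hc
  have him := congrArg Complex.im hc
  simp only [Fin.sum_univ_three, sq, Complex.add_re, Complex.add_im, Complex.mul_re, Complex.mul_im,
    Complex.zero_re, Complex.zero_im] at hre him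
  simp only [inner_e3, rePart_apply, Pi.smul_apply, smul_eq_mul, Complex.mul_re, Complex.I_re,
    Complex.I_im]
  constructor <;> linarith

theorem inner_rePart_pos {c : Fin 3 → ℂ} (hc : ∑ k, c k ^ 2 = 0) (hc0 : c ≠ 0) :
    0 < inner ℝ (rePart c) (rePart c) := by
  refine (real_inner_self_nonneg).lt_of_ne' fun h => hc0 ?_
  have h2 := (inner_rePart_of_isotropic hc).2
  rw [h, inner_self_eq_zero] at h2
  rw [inner_self_eq_zero] at h
  funext k
  apply Complex.ext
  · simpa using congrArg (fun v : E3 => v k) h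
  · simpa using congrArg (fun v : E3 => v k) h2

/-- The real inner product of `ℝ³` as a linear map to the dual; `innerSL ℝ` is the same map, typed
as conjugate-linear. -/
noncomputable def innerCLM : E3 →L[ℝ] E3 →L[ℝ] ℝ :=
  LinearMap.toContinuousLinearMap
    { toFun := fun v => innerSL ℝ v
      map_add' := fun v w => map_add _ v w
      map_smul' := fun r v => by ext; simp }

variable {F : ℂ → Fin 3 → ℂ} {U : Set ℂ}

/-- The surface `Re F` in `ℝ³`. -/
noncomputable def realSurface (F : ℂ → Fin 3 → ℂ) (u : EuclideanSpace ℝ (Fin 2)) : E3 :=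
  rePart (F (planeToComplex u))

theorem hasFDerivAt_comp_planeToComplex {G : ℂ → Fin 3 → ℂ} {u : EuclideanSpace ℝ (Fin 2)}
    (hG : AnalyticAt ℂ G (planeToComplex u)) :
    HasFDerivAt (fun u => G (planeToComplex u))
      ((planeToComplex.toContinuousLinearEquiv.toContinuousLinearMap).smulRight
        (deriv G (planeToComplex u))) u := by
  have h1 := hG.differentiableAt.hasDerivAt.hasFDerivAt.restrictScalars ℝ
  exact h1.comp u planeToComplex.toContinuousLinearEquiv.hasFDerivAt

theorem hasFDerivAt_realSurface {u : EuclideanSpace ℝ (Fin 2)}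
    (hF : AnalyticAt ℂ F (planeToComplex u)) :
    HasFDerivAt (realSurface F) (reDiff (deriv F (planeToComplex u))) u :=
  rePart.hasFDerivAt.comp u (hasFDerivAt_comp_planeToComplex hF)

theorem isImmersedSubmanifold_realSurface (hUo : IsOpen U) (hUc : IsConnected U)
    (hF : ∀ z ∈ U, AnalyticAt ℂ F z) (hF0 : ∀ z ∈ U, deriv F z ≠ 0)
    (hiso : ∀ z ∈ U, ∑ k, deriv F z k ^ 2 = 0) :
    IsImmersedSubmanifold (planeToComplex ⁻¹' U) (realSurface F) where
  isOpen := hUo.preimage planeToComplex.continuous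
  isConnected := by
    have h := planeToComplex.toHomeomorph.isConnected_preimage (s := U)
    exact h.2 hUc
  contDiffOn := by
    intro u hu
    have h1 : AnalyticAt ℝ F (planeToComplex u) := (hF _ hu).restrictScalars
    have h2 := h1.contDiffAt (n := ∞)
    exact (rePart.contDiff.contDiffAt.comp u
      (h2.comp u planeToComplex.toContinuousLinearEquiv.contDiff.contDiffAt)).contDiffWithinAt
  injective_fderiv := by
    intro u hu
    rw [(hasFDerivAt_realSurface (hF _ hu)).fderiv, injective_iff_map_eq_zero]
    intro w hw
    set c := deriv F (planeToComplex u)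
    obtain ⟨h12, h22⟩ := inner_rePart_of_isotropic (hiso _ hu)
    have hpos := inner_rePart_pos (hiso _ hu) (hF0 _ hu)
    rw [reDiff_eq] at hw
    have h1 := congrArg (inner ℝ (rePart c)) hw
    have h2 := congrArg (inner ℝ (rePart (Complex.I • c))) hw
    rw [inner_add_right, real_inner_smul_right, real_inner_smul_right, h12, inner_zero_right] at h1
    rw [inner_add_right, real_inner_smul_right, real_inner_smul_right, real_inner_comm, h12, h22,
      inner_zero_right] at h2
    rw [mul_zero, add_zero, mul_eq_zero] at h1
    rw [mul_zero, zero_add, mul_eq_zero] at h2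
    ext k
    fin_cases k
    · exact h1.resolve_right hpos.ne'
    · exact h2.resolve_right hpos.ne'

/-- The differential of the normal equation of `Re F`: the second term, the second fundamental form
of `Re F` paired with the normal vector, comes from `F''`. -/
theorem fderiv_normalEquation_realSurface {p : EuclideanSpace ℝ (Fin 2) × E3}
    (hF : AnalyticAt ℂ F (planeToComplex p.1)) (a : EuclideanSpace ℝ (Fin 2)) (b : E3)
    (w : EuclideanSpace ℝ (Fin 2)) :
    fderiv ℝ (normalEquation (realSurface F)) p (a, b) w =
      inner ℝ b (reDiff (deriv F (planeToComplex p.1)) w) +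
        inner ℝ p.2 (reDiff (planeToComplex a • deriv (deriv F) (planeToComplex p.1)) w) := by
  have hev : normalEquation (realSurface F) =ᶠ[𝓝 p]
      fun p => (innerCLM p.2).comp (reDiff (deriv F (planeToComplex p.1))) := by
    have hcont : ContinuousAt (fun p : EuclideanSpace ℝ (Fin 2) × E3 => planeToComplex p.1) p := by
      fun_prop
    filter_upwards [hcont.eventually hF.eventually_analyticAt] with y hy
    rw [normalEquation, (hasFDerivAt_realSurface hy).fderiv]
    rfl
  have h1 : HasFDerivAt (fun p : EuclideanSpace ℝ (Fin 2) × E3 => innerCLM p.2)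
      (innerCLM.comp (ContinuousLinearMap.snd ℝ (EuclideanSpace ℝ (Fin 2)) E3)) p :=
    (innerCLM.comp (ContinuousLinearMap.snd ℝ (EuclideanSpace ℝ (Fin 2)) E3)).hasFDerivAt
  have h2 : HasFDerivAt
      (fun p : EuclideanSpace ℝ (Fin 2) × E3 => deriv F (planeToComplex p.1))
      (((planeToComplex.toContinuousLinearEquiv.toContinuousLinearMap).smulRight
        (deriv (deriv F) (planeToComplex p.1))).comp
          (ContinuousLinearMap.fst ℝ (EuclideanSpace ℝ (Fin 2)) E3)) p :=
    HasFDerivAt.comp p (hasFDerivAt_comp_planeToComplex hF.deriv)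
      (ContinuousLinearMap.fst ℝ (EuclideanSpace ℝ (Fin 2)) E3).hasFDerivAt
  have h3 : HasFDerivAt
      (fun p : EuclideanSpace ℝ (Fin 2) × E3 => reDiff (deriv F (planeToComplex p.1)))
      (reDiff.comp (((planeToComplex.toContinuousLinearEquiv.toContinuousLinearMap).smulRight
        (deriv (deriv F) (planeToComplex p.1))).comp
          (ContinuousLinearMap.fst ℝ (EuclideanSpace ℝ (Fin 2)) E3))) p :=
    reDiff.hasFDerivAt.comp p h2
  have h4 := h1.clm_comp h3
  rw [(h4.congr_of_eventuallyEq hev).fderiv]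
  exact add_comm _ _

theorem fderiv_normalBundleMap_realSurface {p : EuclideanSpace ℝ (Fin 2) × E3}
    (hF : AnalyticAt ℂ F (planeToComplex p.1)) (a : EuclideanSpace ℝ (Fin 2)) (b : E3) :
    fderiv ℝ (normalBundleMap (realSurface F)) p (a, b) =
      complexPoint (reDiff (deriv F (planeToComplex p.1)) a) b := by
  have h1 := (hasFDerivAt_realSurface hF).comp p
    (ContinuousLinearMap.fst ℝ (EuclideanSpace ℝ (Fin 2)) E3).hasFDerivAt
  have h2 := (complexPointCLM 3).hasFDerivAt.comp p
    (h1.prodMk (ContinuousLinearMap.snd ℝ (EuclideanSpace ℝ (Fin 2)) E3).hasFDerivAt)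
  have h3 : HasFDerivAt (normalBundleMap (realSurface F)) _ p := h2
  rw [h3.fderiv]
  rfl

/-- The normal bundle of the real part of an isotropic holomorphic curve is special Lagrangian of
phase `i`: the curve's derivative gives a conformal tangent frame, and its second derivative a
second fundamental form that is traceless because `Re F` is harmonic. -/
theorem isSpecialLagrangianNormalBundle_realSurface
    (hF : ∀ z ∈ U, AnalyticAt ℂ F z) (hF0 : ∀ z ∈ U, deriv F z ≠ 0)
    (hiso : ∀ z ∈ U, ∑ k, deriv F z k ^ 2 = 0) :
    IsSpecialLagrangianNormalBundle (Real.pi / 2) (planeToComplex ⁻¹' U) (realSurface F) := by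
  rintro p ⟨hp, -⟩
  set c := deriv F (planeToComplex p.1) with hc
  set d := deriv (deriv F) (planeToComplex p.1) with hd
  obtain ⟨h12, h22⟩ := inner_rePart_of_isotropic (hiso _ hp)
  refine isSpecialLagrangianPlane_of_traceless (e₁ := rePart c) (e₂ := rePart (Complex.I • c))
    (p := inner ℝ p.2 (rePart d)) (q := inner ℝ p.2 (rePart (Complex.I • d)))
    (inner_rePart_pos (hiso _ hp) (hF0 _ hp)) h12 rfl h22 ?_
  have hII : rePart (Complex.I • Complex.I • d) = -rePart d := by
    rw [smul_smul, Complex.I_mul_I, neg_one_smul, map_neg]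
  have hker : ∀ (a w : EuclideanSpace ℝ (Fin 2)) (b : E3),
      fderiv ℝ (normalEquation (realSurface F)) p (a, b) w =
        w 0 * (inner ℝ b (rePart c) + (a 0 * inner ℝ p.2 (rePart d)
          + a 1 * inner ℝ p.2 (rePart (Complex.I • d)))) +
        w 1 * (inner ℝ b (rePart (Complex.I • c)) + (a 0 * inner ℝ p.2 (rePart (Complex.I • d))
          - a 1 * inner ℝ p.2 (rePart d))) := by
    intro a w b
    rw [fderiv_normalEquation_realSurface (hF _ hp), reDiff_eq, reDiff_eq, ← hc, ← hd,
      smul_comm Complex.I (planeToComplex a), rePart_smul (planeToComplex a) d,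
      rePart_smul (planeToComplex a) (Complex.I • d), hII, planeToComplex_apply]
    simp only [inner_add_right, real_inner_smul_right, inner_neg_right]
    simp
    ring
  intro x
  simp only [normalBundleTangentSpace, Submodule.mem_map, LinearMap.mem_ker, Prod.exists,
    ContinuousLinearMap.coe_coe, fderiv_normalBundleMap_realSurface (hF _ hp), ← hc, reDiff_eq]
  constructor
  · rintro ⟨a, b, hab, rfl⟩
    refine ⟨a 0, a 1, b, ?_, ?_, rfl⟩
    · have h := hker a !₂[1, 0] b
      rw [hab] at h
      simp at h
      linarith
    · have h := hker a !₂[0, 1] b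
      rw [hab] at h
      simp at h
      linarith
  · rintro ⟨a₁, a₂, b, h1, h2, rfl⟩
    refine ⟨!₂[a₁, a₂], b, ?_, by simp⟩
    ext w
    rw [hker]
    simp [h1, h2]

end MinimalSurface

/-! ### The Björling construction -/

open Filter Topology

theorem AnalyticAt.cross3_apply {a b : ℝ → E3} {t : ℝ} (ha : AnalyticAt ℝ a t)
    (hb : AnalyticAt ℝ b t) (k : Fin 3) : AnalyticAt ℝ (fun s => cross3 (a s) (b s) k) t := by
  have ha' : ∀ k, AnalyticAt ℝ (fun s => a s k) t := fun k =>
    ((EuclideanSpace.proj k : E3 →L[ℝ] ℝ).analyticAt _).comp ha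
  have hb' : ∀ k, AnalyticAt ℝ (fun s => b s k) t := fun k =>
    ((EuclideanSpace.proj k : E3 →L[ℝ] ℝ).analyticAt _).comp hb
  fin_cases k
  · exact ((ha' 1).mul (hb' 2)).sub ((ha' 2).mul (hb' 1))
  · exact ((ha' 2).mul (hb' 0)).sub ((ha' 0).mul (hb' 2))
  · exact ((ha' 0).mul (hb' 1)).sub ((ha' 1).mul (hb' 0))

theorem AnalyticAt.norm_of_ne_zero {a : ℝ → E3} {t : ℝ} (ha : AnalyticAt ℝ a t) (h0 : a t ≠ 0) :
    AnalyticAt ℝ (fun s => ‖a s‖) t :=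
  (ha.contDiffAt.norm ℝ h0 : ContDiffAt ℝ ω _ t).analyticAt

/-- Isotropy of the derivative of a holomorphic curve propagates over a connected component, by the
identity theorem. -/
theorem sum_sq_deriv_eq_zero_of_frequently {F : ℂ → Fin 3 → ℂ} {W : Set ℂ} {z₀ : ℂ}
    (hF : ∀ z ∈ W, AnalyticAt ℂ F z) (hz₀ : z₀ ∈ W)
    (h0 : ∃ᶠ z in 𝓝[≠] z₀, ∑ k, deriv F z k ^ 2 = 0) :
    ∀ z ∈ connectedComponentIn W z₀, ∑ k, deriv F z k ^ 2 = 0 := by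
  have han : AnalyticOnNhd ℂ (fun z => ∑ k, deriv F z k ^ 2) (connectedComponentIn W z₀) := by
    intro z hz
    have h1 := (hF z (connectedComponentIn_subset W z₀ hz)).deriv
    exact Finset.analyticAt_fun_sum _ fun k _ => (analyticAt_pi_iff.1 h1 k).pow 2
  exact fun z hz => han.eqOn_zero_of_preconnected_of_frequently_eq_zero
    isPreconnected_connectedComponentIn (mem_connectedComponentIn hz₀) h0 hz

/-- Every point of a nontrivial real interval is an accumulation point of the interval in `ℂ`; this
feeds the identity theorem. -/
theorem Set.OrdConnected.frequently_ofReal {I : Set ℝ} (hI : I.OrdConnected)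
    (hI' : I.Nontrivial) {t : ℝ} (ht : t ∈ I) {p : ℂ → Prop} (hp : ∀ s ∈ I, p s) :
    ∃ᶠ z in 𝓝[≠] (t : ℂ), p z := by
  have hacc := hI.isPreconnected.preperfect_of_nontrivial hI' t ht
  rw [accPt_iff_frequently_nhdsNE] at hacc
  have htend : Tendsto (fun s : ℝ => (s : ℂ)) (𝓝[≠] t) (𝓝[≠] (t : ℂ)) :=
    Complex.continuous_ofReal.continuousAt.continuousWithinAt.tendsto_nhdsWithin
      fun s hs => by simpa using hs
  exact htend.frequently (hacc.mono fun s hs => hp s hs)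

theorem mainTheorem1 (I : Set ℝ) (hI : I.OrdConnected) (hI' : I.Nontrivial)
    (γ₁ γ₂ : ℝ → EuclideanSpace ℝ (Fin 3))
    (hγ₁ : AnalyticOnNhd ℝ γ₁ I) (hγ₂ : AnalyticOnNhd ℝ γ₂ I)
    (hreg : ∀ t ∈ I, deriv γ₁ t ≠ 0)
    (horth : ∀ t ∈ I, inner ℝ (deriv γ₁ t) (γ₂ t) = 0)
    (hne : ∀ t ∈ I, γ₂ t ≠ 0) :
    ∃ (U : Set (EuclideanSpace ℝ (Fin 2)))
      (X : EuclideanSpace ℝ (Fin 2) → EuclideanSpace ℝ (Fin 3)),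
      IsImmersedSubmanifold U X ∧
      IsSpecialLagrangianNormalBundle (Real.pi / 2) U X ∧
      ∃ c : ℝ → EuclideanSpace ℝ (Fin 2) × EuclideanSpace ℝ (Fin 3),
        ContinuousOn c I ∧
        ∀ t ∈ I, c t ∈ normalBundle U X ∧
          normalBundleMap X (c t) = complexPoint (γ₁ t) (γ₂ t) := by
  -- With `n = γ₂ / |γ₂|`, this is `n × γ₁'`: the second tangent vector along the curve of a surface
  -- that contains `γ₁`, has unit normal `n` there, and is parametrized conformally.
  set ψ : ℝ → E3 := fun t => ‖γ₂ t‖⁻¹ • cross3 (γ₂ t) (deriv γ₁ t) with hψ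
  have hψan : ∀ k, AnalyticOnNhd ℝ (fun t => ψ t k) I := fun k t ht =>
    (((hγ₂ t ht).norm_of_ne_zero (hne t ht)).inv (norm_ne_zero_iff.2 (hne t ht))).mul
      ((hγ₂ t ht).cross3_apply (hγ₁ t ht).deriv k)
  choose g hgan hgder using fun k => (hψan k).exists_primitive hI
  -- The Schwarz curve `γ₁ - i ∫ n × γ₁'`.
  set φ : ℝ → Fin 3 → ℂ := fun t k => (γ₁ t k : ℂ) - Complex.I * (g k t : ℂ) with hφ
  have hγ₁an : ∀ t ∈ I, ∀ k, AnalyticAt ℝ (fun s => γ₁ s k) t := fun t ht k =>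
    ((EuclideanSpace.proj k : E3 →L[ℝ] ℝ).analyticAt _).comp (hγ₁ t ht)
  have hφan : ∀ t ∈ I, AnalyticAt ℝ φ t := fun t ht => AnalyticAt.pi fun k =>
    ((Complex.ofRealCLM.analyticAt _).comp (hγ₁an t ht k)).sub
      (analyticAt_const.mul ((Complex.ofRealCLM.analyticAt _).comp (hgan k t ht)))
  set F : ℂ → Fin 3 → ℂ := complexExtension φ with hF
  have hFan : ∀ t ∈ I, AnalyticAt ℂ F t := fun t ht => (hφan t ht).complexExtension
  have hFder : ∀ t ∈ I, ∀ k, deriv F t k = (deriv γ₁ t k : ℂ) - Complex.I * (ψ t k : ℂ) := by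
    intro t ht k
    have h1 : HasDerivAt (fun s : ℝ => F s k) (deriv F t k) t :=
      (hasDerivAt_pi.1 (hFan t ht).differentiableAt.hasDerivAt k).comp_ofReal
    simp only [hF, complexExtension_ofReal] at h1
    have h2 : HasDerivAt (fun s => γ₁ s k) (deriv γ₁ t k) t :=
      (EuclideanSpace.proj k : E3 →L[ℝ] ℝ).hasFDerivAt.comp_hasDerivAt t
        (hγ₁ t ht).differentiableAt.hasDerivAt
    exact h1.unique (h2.ofReal_comp.sub ((hgder k t ht).ofReal_comp.const_mul Complex.I))
  have hre : ∀ t ∈ I, rePart (deriv F t) = deriv γ₁ t := by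
    intro t ht; ext k; simp [hFder t ht]
  have him : ∀ t ∈ I, rePart (Complex.I • deriv F t) = ψ t := by
    intro t ht; ext k; simp [hFder t ht]
  have hψγ : ∀ t ∈ I, inner ℝ (deriv γ₁ t) (ψ t) = 0 := by
    intro t _
    rw [hψ, real_inner_smul_right, inner_cross3_right, mul_zero]
  have hψψ : ∀ t ∈ I, inner ℝ (ψ t) (ψ t) = inner ℝ (deriv γ₁ t) (deriv γ₁ t) := by
    intro t ht
    have h0 : ‖γ₂ t‖ ≠ 0 := norm_ne_zero_iff.2 (hne t ht)
    rw [hψ, real_inner_smul_right, real_inner_smul_left, inner_cross3_self,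
      real_inner_comm (deriv γ₁ t) (γ₂ t), horth t ht, real_inner_self_eq_norm_sq (γ₂ t)]
    field_simp
    ring
  have hiso : ∀ t ∈ I, ∑ k, deriv F t k ^ 2 = 0 := by
    intro t ht
    have h1 := hψγ t ht
    have h2 := hψψ t ht
    simp only [inner_e3] at h1 h2
    have h1' := congrArg Complex.ofReal h1
    have h2' := congrArg Complex.ofReal h2
    push_cast at h1' h2'
    simp only [Fin.sum_univ_three, hFder t ht]
    have hI2 : Complex.I ^ 2 = -1 := Complex.I_sq
    linear_combination (-2 * Complex.I) * h1' - h2' + ((ψ t 0 : ℂ) ^ 2 + (ψ t 1 : ℂ) ^ 2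
      + (ψ t 2 : ℂ) ^ 2) * hI2
  obtain ⟨t₀, ht₀⟩ := hI'.nonempty
  -- The domain: the part of `ℂ` where `F` is a holomorphic immersion, cut down to its component
  -- containing the real interval `I`.
  set W : Set ℂ := {z | AnalyticAt ℂ F z ∧ deriv F z ≠ 0} with hW
  have hWo : IsOpen W := isOpen_iff_eventually.2 fun z hz =>
    hz.1.eventually_analyticAt.and (hz.1.deriv.continuousAt.eventually_ne hz.2)
  have hIW : ∀ t ∈ I, (t : ℂ) ∈ W := fun t ht => ⟨hFan t ht, fun h => hreg t ht (by
    rw [← hre t ht, h, map_zero])⟩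
  set U := connectedComponentIn W (t₀ : ℂ) with hU
  have hUW : U ⊆ W := connectedComponentIn_subset _ _
  have hIU : ∀ t ∈ I, (t : ℂ) ∈ U := by
    have h : (fun t : ℝ => (t : ℂ)) '' I ⊆ U :=
      (hI.isPreconnected.image _ Complex.continuous_ofReal.continuousOn).subset_connectedComponentIn
        ⟨t₀, ht₀, rfl⟩ (by rintro _ ⟨t, ht, rfl⟩; exact hIW t ht)
    exact fun t ht => h ⟨t, ht, rfl⟩
  have hUiso : ∀ z ∈ U, ∑ k, deriv F z k ^ 2 = 0 :=
    sum_sq_deriv_eq_zero_of_frequently (fun z hz => hz.1) (hIW t₀ ht₀)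
      (hI.frequently_ofReal hI' ht₀ hiso)
  refine ⟨planeToComplex ⁻¹' U, realSurface F,
    isImmersedSubmanifold_realSurface hWo.connectedComponentIn
      ⟨⟨t₀, hIU t₀ ht₀⟩, isPreconnected_connectedComponentIn⟩
      (fun z hz => (hUW hz).1) (fun z hz => (hUW hz).2) hUiso,
    isSpecialLagrangianNormalBundle_realSurface
      (fun z hz => (hUW hz).1) (fun z hz => (hUW hz).2) hUiso,
    fun t => (planeToComplex.symm (t : ℂ), γ₂ t), ?_, ?_⟩
  · exact ((planeToComplex.symm.continuous.comp Complex.continuous_ofReal).continuousOn).prodMk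
      fun t ht => (hγ₂ t ht).continuousAt.continuousWithinAt
  · intro t ht
    refine ⟨⟨by simpa using hIU t ht, fun w => ?_⟩, ?_⟩
    · have hd := hasFDerivAt_realSurface (F := F) (u := planeToComplex.symm (t : ℂ))
        (by simpa using hFan t ht)
      rw [hd.fderiv, LinearIsometryEquiv.apply_symm_apply, reDiff_eq, hre t ht, him t ht,
        inner_add_left, real_inner_smul_left, real_inner_smul_left, horth t ht, hψ,
        real_inner_smul_left, real_inner_comm, inner_cross3_left]
      simp
    · have hX : realSurface F (planeToComplex.symm (t : ℂ)) = γ₁ t := by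
        ext k
        simp [realSurface, hF, complexExtension_ofReal, hφ]
      rw [normalBundleMap, hX]
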